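/- Let $\mathcal B$ be a separable complex Banach space with a continuous dense embedding $\mathcal B\subset\mathcal H_2$ in a Hilbert space $\mathcal H_2$, and let $0<p<\infty$. Let $\mathbb S_p[\mathcal H_2]$ be the set of bounded operators $T$ on $\mathcal H_2$ with $\operatorname{Tr}[T^*T]^{p/2}<\infty$, put $\|T\|_p^{\mathcal H_2}=\{\operatorname{Tr}[T^*T]^{p/2}\}^{1/p}$, and let $\mathbb S_p[\mathcal B]=\mathbb S_p[\mathcal H_2]\cap L[\mathcal B]$ be the set of bounded operators $A$ on $\mathcal B$ whose (unique) bounded extension $\bar A$ to $\mathcal H_2$ exists and lies in $\mathbb S_p[\mathcal H_2]$. For such an $A$, let $A^*$ be the restriction of the Hilbert space adjoint $\bar A^*$ to $\mathcal B$, i.e. the operator with domain $\{u\in\mathcal B:\bar A^*u\in\mathcal B\}$ and $A^*u=\bar A^*u$. For $u\in\mathcal B$, a Steadman duality map for $u$ is a functional $f_u^s\in\mathcal B'$ with $f_u^s(x)=\dfrac{\|u\|_{\mathcal B}^2}{\|u\|_{\mathcal H_2}^2}(x,u)_{\mathcal H_2}$ for $x$ in the line spanned by $u$ (read as $0$ if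 $u=0$) and $|f_u^s(x)|\le\|u\|_{\mathcal B}\|x\|_{\mathcal B}$ for all $x\in\mathcal B$. Let $A\in\mathbb S_p[\mathcal B]$, and let $\bar A=\bar U|\bar A|$, $|\bar A|=[\bar A^*\bar A]^{1/2}$, be the polar decomposition of $\bar A$. Suppose that $\bar A=\sum_n\mu_n(\,\cdot\,,\bar\varphi_n)_2\,\bar U\bar\varphi_n$ (strongly), where $\{\bar\varphi_n\}$ is an $\mathcal H_2$-orthonormal family of eigenvectors, $|\bar A|\bar\varphi_n=\mu_n\bar\varphi_n$ with $\mu_n\ge 0$, and every $\bar\varphi_n$ lies in $\mathcal B$. Put $\varphi_n=\bar\varphi_n/\|\bar\varphi_n\|_{\mathcal B}$, and let $f_n^s$ be any Steadman duality map for $\varphi_n$. Then every $A\varphi_n$ lies in the domain of $A^*$, the numbers $\langle A^*A\varphi_n,f_n^s\rangle$ are real and nonnegative, the series below converges, and $$\|A\|_p^{\mathcal B}:=\Big\{\sum_n\langle A^*A\varphi_n,f_n^s\rangle^{p/2}\Big\}^{1/p}=\|\bar A\|_p^{\mathcal H_2}.$$ -/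

import Mathlib

noncomputable section

namespace SchattenBanach

/-- A continuous dense embedding of a complex Banach space `B` in a Hilbert space `H`. -/
structure DenseEmbedding (B H : Type*) [NormedAddCommGroup B] [NormedSpace ℂ B]
    [NormedAddCommGroup H] [InnerProductSpace ℂ H] where
  /-- the embedding, a bounded linear map -/
  toCLM : B →L[ℂ] H
  injective : Function.Injective toCLM
  dense : DenseRange toCLM

section Hilbert

variable {H : Type*} [NormedAddCommGroup H] [InnerProductSpace ℂ H] [CompleteSpace H]

/-- The trace, in `[0, ∞]`, of a positive operator `S`, computed in an orthonormal basis of `H`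
(for positive operators its value is the same in every orthonormal basis). -/
def posTrace (S : H →L[ℂ] H) : ENNReal :=
  ∑' e : (exists_hilbertBasis ℂ H).choose, ENNReal.ofReal (inner ℂ (e : H) (S (e : H))).re

/-- `Tr [T* T] ^ (p / 2)`, in `[0, ∞]`, with the power given by the continuous functional
calculus. -/
def schattenTrace (p : ℝ) (T : H →L[ℂ] H) : ENNReal :=
  posTrace ((ContinuousLinearMap.adjoint T * T) ^ (p / 2))

/-- The Schatten class `S_p[H]`: the operators with `Tr [T* T] ^ (p / 2) < ∞`. -/
def schattenClass (p : ℝ) (H : Type*) [NormedAddCommGroup H] [InnerProductSpace ℂ H]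
    [CompleteSpace H] : Set (H →L[ℂ] H) :=
  {T | schattenTrace p T < ⊤}

/-- The Schatten norm `(Tr [T* T] ^ (p / 2)) ^ (1 / p)` of an operator in `S_p[H]`. -/
def schattenNorm (p : ℝ) (T : H →L[ℂ] H) : ℝ :=
  (schattenTrace p T).toReal ^ (1 / p)

/-- The modulus `|T| = [T* T] ^ (1 / 2)`. -/
def modulus (T : H →L[ℂ] H) : H →L[ℂ] H :=
  CFC.sqrt (ContinuousLinearMap.adjoint T * T)

/-- `U` is the partial isometry of the polar decomposition `T = U |T|`. -/
structure IsPolarFactor (U T : H →L[ℂ] H) : Prop where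
  eq_mul : T = U * modulus T
  norm_map : ∀ x ∈ (U : H →ₗ[ℂ] H).kerᗮ, ‖U x‖ = ‖x‖
  ker_eq : (U : H →ₗ[ℂ] H).ker = (T : H →ₗ[ℂ] H).ker

/-- The singular value expansion `T = ∑ μ_n ( · , ψ_n) U ψ_n`: the `ψ_n` are orthonormal
eigenvectors of `|T|` for the eigenvalues `μ_n ≥ 0`, and `T = U |T|` is the polar decomposition. -/
structure IsSingularSystem {ι : Type*} (T U : H →L[ℂ] H) (μ : ι → ℝ) (ψ : ι → H) : Prop where
  polar : IsPolarFactor U T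
  orthonormal : Orthonormal ℂ ψ
  nonneg : ∀ n, 0 ≤ μ n
  eigen : ∀ n, modulus T (ψ n) = (μ n : ℂ) • ψ n
  expansion : ∀ x, HasSum (fun n => ((μ n : ℂ) * inner ℂ (ψ n) x) • U (ψ n)) (T x)

end Hilbert

section Banach

variable {B H : Type*} [NormedAddCommGroup B] [NormedSpace ℂ B]
  [NormedAddCommGroup H] [InnerProductSpace ℂ H]

/-- `T`, an operator on `H`, extends the operator `A` on `B`. -/
def IsExtension (j : DenseEmbedding B H) (A : B →L[ℂ] B) (T : H →L[ℂ] H) : Prop :=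
  ∀ u, T (j.toCLM u) = j.toCLM (A u)

/-- `f` is a Steadman duality map for `u`, associated with `H`: a Hahn-Banach extension, with
`|f x| ≤ ‖u‖ ‖x‖` on `B`, of the functional `x ↦ (‖u‖_B ^ 2 / ‖u‖_H ^ 2) (x, u)_H` on the line
spanned by `u`. -/
structure IsSteadmanMap (j : DenseEmbedding B H) (u : B) (f : B →L[ℂ] ℂ) : Prop where
  on_span : ∀ x ∈ Submodule.span ℂ {u},
    f x = ((‖u‖ ^ 2 / ‖j.toCLM u‖ ^ 2 : ℝ) : ℂ) * inner ℂ (j.toCLM u) (j.toCLM x)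
  bound : ∀ x, ‖f x‖ ≤ ‖u‖ * ‖x‖

/-- The restriction to `B` of an operator `S` on `H`: the linear operator on `B` with domain
`{u ∈ B | S u ∈ B}` which sends `u` to `S u`. -/
def restrictToB (j : DenseEmbedding B H) (S : H →L[ℂ] H) : B →ₗ.[ℂ] B where
  domain := (j.toCLM : B →ₗ[ℂ] H).range.comap ((S ∘L j.toCLM : B →L[ℂ] H) : B →ₗ[ℂ] H)
  toFun :=
    (LinearEquiv.ofInjective (j.toCLM : B →ₗ[ℂ] H) j.injective).symm.toLinearMap ∘ₗ
      (((S ∘L j.toCLM : B →L[ℂ] H) : B →ₗ[ℂ] H).restrict fun _ hu => hu)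

variable [CompleteSpace H]

/-- The adjoint `A*` on `B` of an operator `A` on `B` with extension `T` to `H`: the restriction
to `B` of the Hilbert space adjoint `T*`. -/
def banachAdjoint (j : DenseEmbedding B H) (T : H →L[ℂ] H) : B →ₗ.[ℂ] B :=
  restrictToB j (ContinuousLinearMap.adjoint T)

/-- The Schatten class `S_p[B] = S_p[H] ∩ L[B]`: the bounded operators on `B` that extend to
an operator in `S_p[H]`. -/
def banachSchattenClass (j : DenseEmbedding B H) (p : ℝ) : Set (B →L[ℂ] B) :=
  {A | ∃ T ∈ schattenClass p H, IsExtension j A T}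

/-- The pairing `⟨A* A u, f⟩`, for `u` in the domain of `A* A`; `T` is the extension of `A`. -/
def starPairing (j : DenseEmbedding B H) (A : B →L[ℂ] B) (T : H →L[ℂ] H) (u : B)
    (hu : A u ∈ (banachAdjoint j T).domain) (f : B →L[ℂ] ℂ) : ℂ :=
  f (banachAdjoint j T ⟨A u, hu⟩)

/-- `(∑ ⟨A* A φ_n, f_n⟩ ^ (p / 2)) ^ (1 / p)`, for pairings that are nonnegative reals. -/
def banachSchattenNorm {ι : Type*} (j : DenseEmbedding B H) (p : ℝ) (A : B →L[ℂ] B)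
    (T : H →L[ℂ] H) (φ : ι → B) (hφ : ∀ n, A (φ n) ∈ (banachAdjoint j T).domain)
    (f : ι → B →L[ℂ] ℂ) : ℝ :=
  (∑' n, (starPairing j A T (φ n) (hφ n) (f n)).re ^ (p / 2)) ^ (1 / p)

end Banach

end SchattenBanach

end

namespace SchattenBanach

section Hilbert

/-! Both sides reduce to `∑ μ_n ^ p`. On the Banach side, `ψ_n` is an eigenvector of `T* T` for `μ_n
^ 2` lying in `B`, so `A* A φ_n = μ_n ^ 2 φ_n`. A Steadman map takes the value `‖φ_n‖ ^ 2 = 1` at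
`φ_n`, so each pairing is `μ_n ^ 2`, whichever Hahn-Banach extension is chosen. On the Hilbert side,
the `ψ_n` are completed to a Hilbert basis. The expansion forces `T` to vanish on the added vectors,
so `(T* T) ^ (p / 2)` is diagonal (`cfc_apply_of_apply_eq_smul`) and its trace is the sum of its
diagonal entries (`posTrace_eq_tsum`). -/

theorem tsum_ofReal_norm_inner_sq {κ H : Type*} [NormedAddCommGroup H] [InnerProductSpace ℂ H]
    (b : HilbertBasis κ ℂ H) (x : H) :
    ∑' i, ENNReal.ofReal (‖inner ℂ (b i) x‖ ^ 2) = ENNReal.ofReal (‖x‖ ^ 2) := by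
  have h := (Complex.hasSum_re (b.hasSum_inner_mul_inner x x))
  have hterm : ∀ i, (inner ℂ x (b i) * inner ℂ (b i) x).re = ‖inner ℂ (b i) x‖ ^ 2 := fun i => by
    rw [← inner_conj_symm x (b i), ← Complex.normSq_eq_conj_mul_self, Complex.ofReal_re,
      Complex.normSq_eq_norm_sq]
  simp_rw [hterm] at h
  rw [← ENNReal.ofReal_tsum_of_nonneg (fun _ => by positivity) h.summable, h.tsum_eq]
  exact congrArg ENNReal.ofReal (inner_self_eq_norm_sq (𝕜 := ℂ) x)

variable {H : Type*} [NormedAddCommGroup H] [InnerProductSpace ℂ H]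

theorem aeval_apply_of_apply_eq_smul {M : H →L[ℂ] H} {v : H} {c : ℝ} (hv : M v = (c : ℂ) • v)
    (q : Polynomial ℝ) : Polynomial.aeval M q v = ((q.eval c : ℝ) : ℂ) • v := by
  induction q using Polynomial.induction_on' with
  | add p q hp hq => simp [hp, hq, add_smul]
  | monomial n a =>
    have hpow : (M ^ n) v = ((c : ℂ) ^ n) • v := by
      induction n with
      | zero => simp
      | succ n ih => rw [pow_succ, mul_apply_eq_comp, hv, map_smul, ih, smul_smul,
          pow_succ, mul_comm]
    rw [Polynomial.aeval_monomial, mul_apply_eq_comp, hpow, Algebra.algebraMap_eq_smul_one]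
    rw [smul_apply, one_apply_eq_self, Polynomial.eval_monomial,
      Complex.ofReal_mul, Complex.ofReal_pow, mul_smul, Complex.coe_smul]

variable [CompleteSpace H]

/-- Clear for polynomials; the general case follows by Weierstrass approximation, uniform on an
interval containing both the spectrum and `c`. -/
theorem cfc_apply_of_apply_eq_smul {M : H →L[ℂ] H} (hM : IsSelfAdjoint M) {v : H} {c : ℝ}
    (hv : M v = (c : ℂ) • v) {g : ℝ → ℝ} (hg : Continuous g) :
    cfc g M v = ((g c : ℝ) : ℂ) • v := by
  rw [← sub_eq_zero, ← norm_eq_zero]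
  refine le_antisymm (le_of_forall_pos_le_add fun ε hε => ?_) (norm_nonneg _)
  set δ : ℝ := ε / (2 * (‖v‖ + 1)) with hδ
  have hδ0 : 0 < δ := by positivity
  -- Including `|c|` avoids proving that `c` is in the spectrum, which may fail when `v = 0`.
  set R : ℝ := max (‖M‖ * ‖(1 : H →L[ℂ] H)‖) |c| with hR
  obtain ⟨q, hq⟩ := exists_polynomial_near_of_continuousOn (-R) R g hg.continuousOn δ hδ0
  have hc : |q.eval c - g c| ≤ δ :=
    (hq c (abs_le.mp (le_max_right _ _))).le
  have hnorm : ‖cfc g M - Polynomial.aeval M q‖ ≤ δ := by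
    rw [← cfc_polynomial q M, ← cfc_sub g (fun x => q.eval x) M hg.continuousOn
      q.continuous.continuousOn]
    refine norm_cfc_le hδ0.le fun x hx => ?_
    rw [norm_sub_rev]
    refine (hq x (abs_le.mp ?_)).le
    exact (spectrum.norm_le_norm_mul_of_mem hx).trans (le_max_left _ _)
  have hsplit : cfc g M v - ((g c : ℝ) : ℂ) • v
      = (cfc g M - Polynomial.aeval M q) v + ((q.eval c - g c : ℝ) : ℂ) • v := by
    rw [sub_apply, aeval_apply_of_apply_eq_smul hv]
    push_cast
    module
  rw [hsplit, zero_add]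
  calc _ ≤ ‖(cfc g M - Polynomial.aeval M q) v‖ + ‖((q.eval c - g c : ℝ) : ℂ) • v‖ :=
        norm_add_le _ _
    _ ≤ δ * ‖v‖ + δ * ‖v‖ := by
        gcongr
        · exact (ContinuousLinearMap.le_opNorm _ _).trans (by gcongr)
        · rw [norm_smul, Complex.norm_real, Real.norm_eq_abs]
          gcongr
    _ = ε * (‖v‖ / (‖v‖ + 1)) := by rw [hδ]; field_simp; ring
    _ ≤ ε := mul_le_of_le_one_right hε.le
        ((div_le_one (by positivity)).mpr (by linarith))

theorem rpow_apply_of_apply_eq_smul {M : H →L[ℂ] H} (hM : 0 ≤ M) {v : H} {c r : ℝ} (hr : 0 ≤ r)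
    (hv : M v = (c : ℂ) • v) : (M ^ r) v = ((c ^ r : ℝ) : ℂ) • v := by
  rw [CFC.rpow_eq_cfc_real hM]
  exact cfc_apply_of_apply_eq_smul (IsSelfAdjoint.of_nonneg hM) hv (Real.continuous_rpow_const hr)

/-- The trace of an operator that is diagonal, with nonnegative entries, in some Hilbert basis. -/
theorem posTrace_eq_tsum {κ : Type*} (b : HilbertBasis κ ℂ H) (S : H →L[ℂ] H) {c : κ → ℝ}
    (hc : ∀ i, 0 ≤ c i) (hS : ∀ i, S (b i) = (c i : ℂ) • b i) :
    posTrace S = ∑' i, ENNReal.ofReal (c i) := by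
  obtain ⟨d, hd⟩ := (exists_hilbertBasis ℂ H).choose_spec
  have hform : ∀ x, ENNReal.ofReal (inner ℂ x (S x)).re
      = ∑' i, ENNReal.ofReal (c i) * ENNReal.ofReal (‖inner ℂ (b i) x‖ ^ 2) := fun x => by
    have h1 := (b.hasSum_repr x).mapL S
    have h2 := Complex.hasSum_re (h1.mapL (innerSL ℂ x))
    have hterm : ∀ i, ((innerSL ℂ x) (S (b.repr x i • b i))).re
        = c i * ‖inner ℂ (b i) x‖ ^ 2 := fun i => by
      rw [map_smul, hS, b.repr_apply_apply, innerSL_apply_apply, inner_smul_right, inner_smul_right,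
        ← inner_conj_symm x (b i), mul_left_comm, ← Complex.normSq_eq_norm_sq, Complex.mul_conj,
        ← Complex.ofReal_mul, Complex.ofReal_re]
    simp_rw [hterm] at h2
    simp_rw [← ENNReal.ofReal_mul (hc _)]
    rw [← ENNReal.ofReal_tsum_of_nonneg (fun i => mul_nonneg (hc i) (by positivity)) h2.summable,
      h2.tsum_eq, innerSL_apply_apply]
  have hd' : ∀ e : (exists_hilbertBasis ℂ H).choose, (e : H) = d e := fun e => by rw [hd]
  rw [posTrace]
  simp_rw [hform]
  rw [ENNReal.tsum_comm]
  refine tsum_congr fun i => ?_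
  simp_rw [ENNReal.tsum_mul_left, hd', fun e => norm_inner_symm (𝕜 := ℂ) (b i) (d e)]
  rw [tsum_ofReal_norm_inner_sq d, b.orthonormal.1 i]
  simp

theorem adjoint_mul_self_nonneg (T : H →L[ℂ] H) : 0 ≤ ContinuousLinearMap.adjoint T * T :=
  star_mul_self_nonneg T

variable {ι : Type*} {T U : H →L[ℂ] H} {μ : ι → ℝ} {ψ : ι → H}

theorem IsSingularSystem.adjoint_mul_self_apply (h : IsSingularSystem T U μ ψ) (n : ι) :
    (ContinuousLinearMap.adjoint T * T) (ψ n) = ((μ n ^ 2 : ℝ) : ℂ) • ψ n := by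
  rw [← CFC.sqrt_mul_sqrt_self _ (adjoint_mul_self_nonneg T)]
  change modulus T (modulus T (ψ n)) = _
  rw [h.eigen, map_smul, h.eigen, smul_smul, sq, Complex.ofReal_mul]

theorem IsSingularSystem.apply_eq_zero (h : IsSingularSystem T U μ ψ) {x : H}
    (hx : ∀ n, inner ℂ (ψ n) x = 0) : T x = 0 := by
  have := h.expansion x
  simp only [hx, mul_zero, zero_smul] at this
  exact this.unique hasSum_zero

theorem IsSingularSystem.schattenTrace_eq (h : IsSingularSystem T U μ ψ) {p : ℝ} (hp : 0 < p) :
    schattenTrace p T = ∑' n, ENNReal.ofReal ((μ n ^ 2) ^ (p / 2)) := by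
  classical
  obtain ⟨w, b, hw, hb⟩ := h.orthonormal.toSubtypeRange.exists_hilbertBasis_extension
  have hinj := h.orthonormal.linearIndependent.injective
  let e : ι → w := fun n => ⟨ψ n, hw ⟨n, rfl⟩⟩
  have he : Function.Injective e := fun m n hmn => hinj (congrArg Subtype.val hmn)
  have hbe : ∀ n, b (e n) = ψ n := fun n => by rw [hb]
  -- The entries are zero on the basis vectors added to the `ψ_n`, where `T` vanishes.
  let c : w → ℝ := Function.extend e (fun n => (μ n ^ 2) ^ (p / 2)) 0
  have hce : ∀ n, c (e n) = (μ n ^ 2) ^ (p / 2) := fun n => he.extend_apply _ _ _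
  have hc0 : ∀ i, i ∉ Set.range e → c i = 0 := fun i hi =>
    Function.extend_apply' _ _ _ hi
  have hpos := adjoint_mul_self_nonneg T
  have hp2 : 0 < p / 2 := by positivity
  rw [schattenTrace, posTrace_eq_tsum b _ (c := c)]
  · rw [← he.tsum_eq (f := fun i => ENNReal.ofReal (c i))]
    · simp_rw [hce]
    · intro i hi
      by_contra hne
      exact hi (by simp [hc0 i hne])
  · intro i
    by_cases hi : i ∈ Set.range e
    · obtain ⟨n, rfl⟩ := hi
      rw [hce]
      positivity
    · rw [hc0 i hi]
  · intro i
    by_cases hi : i ∈ Set.range e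
    · obtain ⟨n, rfl⟩ := hi
      rw [hce, hbe]
      exact rpow_apply_of_apply_eq_smul hpos hp2.le (h.adjoint_mul_self_apply n)
    · have hT : T (b i) = 0 := h.apply_eq_zero fun n => by
        rw [← hbe n]
        exact b.orthonormal.2 fun hni => hi ⟨n, hni⟩
      -- The eigenvalue `0` stays `0` under the power because `p / 2 ≠ 0`.
      have h0 := rpow_apply_of_apply_eq_smul (v := b i) (c := 0) hpos hp2.le
        (by simp [hT])
      rw [h0, hc0 i hi, Real.zero_rpow hp2.ne']

end Hilbert

section Banach

variable {B H : Type*} [NormedAddCommGroup B] [NormedSpace ℂ B]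
  [NormedAddCommGroup H] [InnerProductSpace ℂ H] {j : DenseEmbedding B H}

theorem IsExtension.unique {A : B →L[ℂ] B} {S T : H →L[ℂ] H} (hS : IsExtension j A S)
    (hT : IsExtension j A T) : S = T :=
  DFunLike.coe_injective <| j.dense.equalizer S.continuous T.continuous <|
    funext fun u => (hS u).trans (hT u).symm

theorem toCLM_restrictToB (S : H →L[ℂ] H) (u : (restrictToB j S).domain) :
    j.toCLM (restrictToB j S u) = S (j.toCLM u) :=
  congrArg Subtype.val ((LinearEquiv.ofInjective (j.toCLM : B →ₗ[ℂ] H) j.injective).apply_symm_apply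
    ⟨S (j.toCLM u), u.2⟩)

theorem restrictToB_apply_eq {S : H →L[ℂ] H} (u : (restrictToB j S).domain) {v : B}
    (hv : S (j.toCLM u) = j.toCLM v) : restrictToB j S u = v :=
  j.injective ((toCLM_restrictToB S u).trans hv)

theorem IsSteadmanMap.apply_self {u : B} {f : B →L[ℂ] ℂ} (hf : IsSteadmanMap j u f) :
    f u = ((‖u‖ ^ 2 : ℝ) : ℂ) := by
  rw [hf.on_span u (Submodule.mem_span_singleton_self u), inner_self_eq_norm_sq_to_K]
  rcases eq_or_ne u 0 with rfl | hu
  · simp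
  · have : ‖j.toCLM u‖ ≠ 0 := norm_ne_zero_iff.mpr fun h => hu (j.injective (h.trans (map_zero _).symm))
    have h' : ‖u‖ ^ 2 / ‖j.toCLM u‖ ^ 2 * ‖j.toCLM u‖ ^ 2 = ‖u‖ ^ 2 := by field_simp
    have h'' := congrArg (fun r : ℝ => (r : ℂ)) h'
    rw [Complex.ofReal_mul] at h''
    simpa using h''

end Banach

end SchattenBanach

theorem theorem6p2 {B H₂ : Type*}
    [NormedAddCommGroup B] [NormedSpace ℂ B] [CompleteSpace B] [TopologicalSpace.SeparableSpace B]
    [NormedAddCommGroup H₂] [InnerProductSpace ℂ H₂] [CompleteSpace H₂]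
    (j : SchattenBanach.DenseEmbedding B H₂) (p : ℝ) (hp : 0 < p)
    (A : B →L[ℂ] B) (hA : A ∈ SchattenBanach.banachSchattenClass j p)
    (Abar : H₂ →L[ℂ] H₂) (hAbar : SchattenBanach.IsExtension j A Abar)
    {ι : Type*} (U : H₂ →L[ℂ] H₂) (μ : ι → ℝ) (ψ : ι → B)
    (hψ : SchattenBanach.IsSingularSystem Abar U μ (fun n => j.toCLM (ψ n)))
    (φ : ι → B) (hφ : ∀ n, φ n = ((‖ψ n‖⁻¹ : ℝ) : ℂ) • ψ n)
    (f : ι → B →L[ℂ] ℂ) (hf : ∀ n, SchattenBanach.IsSteadmanMap j (φ n) (f n)) :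
    ∃ hdom : ∀ n, A (φ n) ∈ (SchattenBanach.banachAdjoint j Abar).domain,
      (∀ n, 0 ≤ (SchattenBanach.starPairing j A Abar (φ n) (hdom n) (f n)).re ∧
        (SchattenBanach.starPairing j A Abar (φ n) (hdom n) (f n)).im = 0) ∧
      Summable (fun n =>
        (SchattenBanach.starPairing j A Abar (φ n) (hdom n) (f n)).re ^ (p / 2)) ∧
      SchattenBanach.banachSchattenNorm j p A Abar φ hdom f =
        SchattenBanach.schattenNorm p Abar := by
  -- Membership of `A` supplies some extension of finite trace; density of `B` identifies it with
  -- `Abar`.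
  have hext : SchattenBanach.schattenTrace p Abar ≠ ⊤ := by
    obtain ⟨T, hT, hAT⟩ := hA
    rw [hAbar.unique hAT]
    exact (show SchattenBanach.schattenTrace p T < ⊤ from hT).ne
  have heig : ∀ n, ContinuousLinearMap.adjoint Abar (j.toCLM (A (φ n)))
      = j.toCLM (((μ n ^ 2 : ℝ) : ℂ) • φ n) := fun n => by
    have h := hψ.adjoint_mul_self_apply n
    rw [mul_apply_eq_comp] at h
    rw [← hAbar, hφ]
    simp only [map_smul, h]
    rw [smul_comm]
  -- The witness in `B` is `μ_n ^ 2 φ_n`.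
  have hdom : ∀ n, A (φ n) ∈ (SchattenBanach.banachAdjoint j Abar).domain := fun n =>
    ⟨_, (heig n).symm⟩
  have hψ0 : ∀ n, ψ n ≠ 0 := fun n h0 => hψ.orthonormal.ne_zero n (by simp [h0])
  have hφ1 : ∀ n, ‖φ n‖ = 1 := fun n => by
    rw [hφ, norm_smul, Complex.norm_real, norm_inv, norm_norm,
      inv_mul_cancel₀ (norm_ne_zero_iff.mpr (hψ0 n))]
  have hpair : ∀ n, SchattenBanach.starPairing j A Abar (φ n) (hdom n) (f n)
      = ((μ n ^ 2 : ℝ) : ℂ) := fun n => by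
    have h : SchattenBanach.banachAdjoint j Abar ⟨A (φ n), hdom n⟩
        = ((μ n ^ 2 : ℝ) : ℂ) • φ n := SchattenBanach.restrictToB_apply_eq _ (heig n)
    rw [SchattenBanach.starPairing, h, map_smul, (hf n).apply_self, hφ1]
    simp
  have hnn : ∀ n, 0 ≤ (μ n ^ 2) ^ (p / 2) := fun n => by positivity
  have htr := hψ.schattenTrace_eq hp
  have hsum : Summable fun n => (μ n ^ 2) ^ (p / 2) := by
    rw [htr] at hext
    simpa only [ENNReal.toReal_ofReal (hnn _)] using ENNReal.summable_toReal hext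
  refine ⟨hdom, fun n => ?_, ?_, ?_⟩
  · rw [hpair, Complex.ofReal_re, Complex.ofReal_im]
    exact ⟨sq_nonneg _, rfl⟩
  · simpa only [hpair, Complex.ofReal_re] using hsum
  · rw [SchattenBanach.banachSchattenNorm, SchattenBanach.schattenNorm, htr,
      ← ENNReal.ofReal_tsum_of_nonneg hnn hsum, ENNReal.toReal_ofReal (tsum_nonneg hnn)]
    simp only [hpair, Complex.ofReal_re]
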